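/- A cylindric partition of rank $4$ with profile $c=(c_1,c_2,c_3,c_4)=(2,0,0,0)$ (so of level $c_1+c_2+c_3+c_4=2$) is a vector $\Lambda=(\lambda^{(1)},\lambda^{(2)},\lambda^{(3)},\lambda^{(4)})$ of ordinary (possibly empty) partitions $\lambda^{(i)}=(\lambda^{(i)}_1\ge\lambda^{(i)}_2\ge\cdots)$, each padded with zeros, such that for all $j\ge 1$ $$\lambda^{(i)}_j\ge\lambda^{(i+1)}_{j+c_{i+1}}\quad(1\le i\le 3),\qquad \lambda^{(4)}_j\ge\lambda^{(1)}_{j+c_1}.$$ Its size $|\Lambda|$ is the sum of all the parts of the $\lambda^{(i)}$. Write $(a;q)_n=\prod_{k=1}^n(1-aq^{k-1})$ and $(a;q)_\infty=\lim_{n\to\infty}(a;q)_n$. Let $P_{(2,0,0,0)}$ be the set of all cylindric partitions with profile $(2,0,0,0)$. Then for every $q\in\mathbb{C}$ with $|q|<1$, both series below converge absolutely and $$\sum_{\Lambda\in P_{(2,0,0,0)}}q^{|\Lambda|}=\left(\sum_{n\ge 0}\frac{q^{n(n+1)}\,(-q^2;q^2)_n}{(-q^3;q^2)_n\,(q^2;q^2)_n}\right)\cdot\frac{(-q^3;q^2)_\infty}{(q;q)_\infty}.$$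 -/

import Mathlib

open Filter Topology

/-- An ordinary partition `λ₁ ≥ λ₂ ≥ ⋯` (possibly empty), padded with zeros: a non-increasing
sequence of natural numbers with only finitely many nonzero terms. The index is shifted by one:
`parts j` is the part `λ_{j+1}`. The nonzero values are the parts of the partition. -/
@[ext]
structure OrdinaryPartition where
  parts : ℕ →₀ ℕ
  antitone_parts : Antitone parts

namespace OrdinaryPartition

/-- The sum of the parts of a partition. -/
def size (p : OrdinaryPartition) : ℕ := p.parts.sum fun _ x => x

end OrdinaryPartition

/-- A cylindric partition of rank `r` with profile `c = (c₁, …, c_r)` (non-negative integers,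
`c i` being `c_{i+1}`): a vector `(λ⁽¹⁾, …, λ⁽ʳ⁾)` of ordinary partitions with
`λ⁽ⁱ⁾_j ≥ λ⁽ⁱ⁺¹⁾_{j + c_{i+1}}` for all `1 ≤ i < r` and `λ⁽ʳ⁾_j ≥ λ⁽¹⁾_{j + c_1}`, for all `j`.
Addition in `Fin r` is cyclic, so that the successor of the last index is the first one. -/
@[ext]
structure CylindricPartition {r : ℕ} [NeZero r] (c : Fin r → ℕ) where
  row : Fin r → OrdinaryPartition
  row_le : ∀ (i : Fin r) (j : ℕ), (row (i + 1)).parts (j + c (i + 1)) ≤ (row i).parts j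

namespace CylindricPartition

/-- The size `|Λ|`: the sum of all the parts of all the partitions in `Λ`. -/
def size {r : ℕ} [NeZero r] {c : Fin r → ℕ} (Λ : CylindricPartition c) : ℕ :=
  ∑ i, (Λ.row i).size

end CylindricPartition

/-- The finite `q`-Pochhammer symbol `(a; q)_n = ∏_{k=1}^n (1 - a q^{k-1})`. -/
def qPochhammer (a q : ℂ) (n : ℕ) : ℂ := ∏ k ∈ Finset.range n, (1 - a * q ^ k)

/-- The infinite `q`-Pochhammer symbol `(a; q)_∞ = lim_{n → ∞} (a; q)_n`. -/
noncomputable def qPochhammerInf (a q : ℂ) : ℂ := limUnder atTop (qPochhammer a q)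

/-- For `|q| < 1` the limit that defines `(a; q)_∞` exists. -/
theorem tendsto_qPochhammer (a q : ℂ) (hq : ‖q‖ < 1) :
    Tendsto (qPochhammer a q) atTop (𝓝 (qPochhammerInf a q)) := by
  have hs : Summable fun k : ℕ => ‖-(a * q ^ k)‖ := by
    simp only [norm_neg, norm_mul, norm_pow]
    exact (summable_geometric_of_lt_one (norm_nonneg q) hq).mul_left ‖a‖
  have hm := (multipliable_one_add_of_summable hs).hasProd.tendsto_prod_nat
  refine tendsto_nhds_limUnder ⟨∏' k : ℕ, (1 + -(a * q ^ k)), ?_⟩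
  have he : qPochhammer a q = fun n => ∏ k ∈ Finset.range n, (1 + -(a * q ^ k)) := by
    funext n
    simp only [qPochhammer, sub_eq_add_neg]
  rw [he]
  exact hm

/-! With indices from zero, reading the entries of even index of the four rows in turn, and likewise
those of odd index, turns Λ into two partitions with λ_{k+4} ≤ μ_k ≤ λ_k: rank 4 and level 2 become
rank 2 and level 4 (`cylindricEquiv`).

Let F_N(d) count pairs with shifts d and 4-d and all parts at most N. Removing the parts equal to
N+1 gives, with t = q^(N+1), F_{N+1}(d) = ∑_e t^|d-e| F_N(e) / (1-t²) (`hasSum_boundedPairs`). This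
matrix has a tridiagonal inverse, so the series ∑ F_N(d) X^N satisfy q-difference equations. They
are solved by φ_d(X)/(X;q)_∞, where the coefficients of φ_d are powers of q times those of L =
(-q²X;q²)_∞/(X;q)_∞, or of (1-X)L if d = 2 (`pairSeries_eq`).

As N → ∞, F_N(4) tends to φ_4(1)/(q;q)_∞ (`tendsto_coeff_levelTotal`), and φ_4(1) is a double series
whose inner sum is evaluated by Euler's identity (`tsum_coeff_seriesA`). -/

namespace OrdinaryPartition

/-! ### Adding and removing the largest parts of one partition -/

theorem hasSum_parts (p : OrdinaryPartition) : HasSum p.parts p.size :=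
  hasSum_sum_of_ne_finset_zero fun k hk => by simpa using hk

theorem size_eq_of_hasSum (p : OrdinaryPartition) {f : ℕ → ℕ} {s : ℕ} (hf : ∀ k, p.parts k = f k)
    (h : HasSum f s) : p.size = s :=
  p.hasSum_parts.unique ((funext hf : ⇑p.parts = f) ▸ h)

/-- Build a partition from an antitone sequence that eventually vanishes. -/
noncomputable def ofAntitone (f : ℕ → ℕ) (hf : Antitone f) (h : ∃ n, f n = 0) : OrdinaryPartition where
  parts := Finsupp.ofSupportFinite f <| by
    obtain ⟨n, hn⟩ := h
    refine (Set.finite_lt_nat n).subset fun k hk => ?_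
    by_contra hkn
    exact hk (Nat.le_zero.1 (hn ▸ hf (not_lt.1 hkn)))
  antitone_parts := hf

@[simp]
theorem ofAntitone_parts (f : ℕ → ℕ) (hf : Antitone f) (h : ∃ n, f n = 0) (k : ℕ) :
    (ofAntitone f hf h).parts k = f k := rfl

theorem ext_parts {p p' : OrdinaryPartition} (h : ∀ k, p.parts k = p'.parts k) : p = p' :=
  OrdinaryPartition.ext (Finsupp.ext h)

theorem exists_parts_eq_zero (p : OrdinaryPartition) : ∃ n, ∀ k, n ≤ k → p.parts k = 0 := by
  obtain ⟨n, hn⟩ := p.parts.support.exists_nat_subset_range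
  refine ⟨n, fun k hk => ?_⟩
  by_contra h
  exact absurd (Finset.mem_range.1 (hn (Finsupp.mem_support_iff.2 h))) (not_lt.2 hk)

/-- Add `x` parts equal to `N` in front of a partition whose parts are at most `N`. -/
noncomputable def prepend (N x : ℕ) (p : OrdinaryPartition) : OrdinaryPartition :=
  -- The maximum is antitone for every `p`; it is the concatenation once the parts of `p` are at
  -- most `N`.
  ofAntitone (fun k => max (if k < x then N else 0) (p.parts (k - x)))
    (fun k l hkl => max_le_max
      (by split_ifs <;> omega)
      (p.antitone_parts (Nat.sub_le_sub_right hkl x)))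
    (by
      obtain ⟨n, hn⟩ := p.exists_parts_eq_zero
      exact ⟨n + x, by simp [hn]⟩)

theorem prepend_parts_of_lt {N x k : ℕ} {p : OrdinaryPartition} (hp : ∀ k, p.parts k ≤ N)
    (hk : k < x) : (prepend N x p).parts k = N := by
  change max (if k < x then N else 0) (p.parts (k - x)) = N
  simp [hk, hp]

theorem prepend_parts_add (N x k : ℕ) (p : OrdinaryPartition) :
    (prepend N x p).parts (k + x) = p.parts k := by
  change max (if k + x < x then N else 0) (p.parts (k + x - x)) = p.parts k
  simp

theorem size_prepend {N : ℕ} (x : ℕ) {p : OrdinaryPartition} (hp : ∀ k, p.parts k ≤ N) :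
    (prepend N x p).size = x * N + p.size := by
  have h : HasSum (fun k => (prepend N x p).parts (k + x)) p.size := by
    simpa only [prepend_parts_add] using p.hasSum_parts
  have h2 := h.summable.sum_add_tsum_nat_add'
  rw [h.tsum_eq, (hasSum_parts _).tsum_eq,
    Finset.sum_congr rfl fun k hk => prepend_parts_of_lt hp (Finset.mem_range.1 hk)] at h2
  simpa using h2.symm

theorem prepend_le {N x : ℕ} {p : OrdinaryPartition} (hp : ∀ k, p.parts k ≤ N) (k : ℕ) :
    (prepend N x p).parts k ≤ N := by
  refine max_le ?_ (hp _)
  split_ifs <;> omega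

theorem lt_iff_prepend_parts {N x k : ℕ} {p : OrdinaryPartition} (hp : ∀ k, p.parts k ≤ N) :
    k < x ↔ (prepend (N + 1) x p).parts k = N + 1 := by
  refine ⟨prepend_parts_of_lt fun k => (hp k).trans N.le_succ, fun h => ?_⟩
  by_contra hk
  obtain ⟨l, rfl⟩ := Nat.exists_eq_add_of_le' (not_lt.1 hk)
  rw [prepend_parts_add] at h
  have := hp l
  omega

theorem prepend_injective {N x x' : ℕ} {p p' : OrdinaryPartition} (hp : ∀ k, p.parts k ≤ N)
    (hp' : ∀ k, p'.parts k ≤ N) (h : prepend (N + 1) x p = prepend (N + 1) x' p') :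
    x = x' ∧ p = p' := by
  have hx : x = x' := eq_of_forall_lt_iff fun k => by
    rw [lt_iff_prepend_parts hp, lt_iff_prepend_parts hp', h]
  subst hx
  refine ⟨rfl, ext_parts fun k => ?_⟩
  rw [← prepend_parts_add (N + 1) x k p, h, prepend_parts_add]

theorem exists_prepend_eq {N : ℕ} {p : OrdinaryPartition} (hp : ∀ k, p.parts k ≤ N + 1) :
    ∃ x p', (∀ k, p'.parts k ≤ N) ∧ prepend (N + 1) x p' = p := by
  classical
  have hex : ∃ k, p.parts k ≤ N := by
    obtain ⟨n, hn⟩ := p.exists_parts_eq_zero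
    exact ⟨n, by simp [hn]⟩
  obtain ⟨n, hn⟩ := p.exists_parts_eq_zero
  let p' := ofAntitone (fun k => p.parts (k + Nat.find hex))
    (fun k l hkl => p.antitone_parts (Nat.add_le_add_right hkl _)) ⟨n, hn _ (Nat.le_add_right _ _)⟩
  have hp' : ∀ k, p'.parts k ≤ N := fun k =>
    (p.antitone_parts (Nat.le_add_left _ _)).trans (Nat.find_spec hex)
  refine ⟨Nat.find hex, p', hp', ext_parts fun k => ?_⟩
  rcases lt_or_ge k (Nat.find hex) with hk | hk
  · rw [prepend_parts_of_lt (fun k => (hp' k).trans N.le_succ) hk]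
    have := Nat.find_min hex hk
    have := hp k
    omega
  · obtain ⟨l, rfl⟩ := Nat.exists_eq_add_of_le' hk
    rw [prepend_parts_add]
    rfl

/-- A value N+1 on the left must face one on the right, which bounds `x`. Beyond both blocks the
same inequality remains, with its shift changed by y - x. -/
theorem prepend_parts_shift_le_iff {N x y a : ℕ} {p p' : OrdinaryPartition}
    (hp : ∀ k, p.parts k ≤ N) (hp' : ∀ k, p'.parts k ≤ N) :
    (∀ k, (prepend (N + 1) x p).parts (k + a) ≤ (prepend (N + 1) y p').parts k) ↔
      x ≤ y + a ∧ ∀ k, p.parts (k + (y + a - x)) ≤ p'.parts k := by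
  constructor
  · intro h
    have hxy : x ≤ y + a := by
      by_contra hlt
      -- Position `y` is the first one where the right side is at most N.
      have h1 := h y
      rw [(lt_iff_prepend_parts hp).1 (not_le.1 hlt)] at h1
      have h2 := prepend_parts_add (N + 1) y 0 p'
      rw [zero_add] at h2
      have := hp' 0
      omega
    refine ⟨hxy, fun k => ?_⟩
    rw [← prepend_parts_add (N + 1) x, ← prepend_parts_add (N + 1) y k p']
    convert h (k + y) using 2
    omega
  · rintro ⟨hxy, h⟩ k
    rcases lt_or_ge k y with hk | hk
    · rw [(lt_iff_prepend_parts hp').1 hk]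
      exact prepend_le (fun k => (hp k).trans N.le_succ) _
    · obtain ⟨l, rfl⟩ := Nat.exists_eq_add_of_le' hk
      have hl : l + y + a = l + (y + a - x) + x := by omega
      rw [hl, prepend_parts_add, prepend_parts_add]
      exact h l

end OrdinaryPartition

/-! ### Interlaced pairs and the recursion in the bound on the parts -/

open OrdinaryPartition

/-- The pairs of partitions `(λ, μ)` with `λ_{k+d} ≤ μ_k` and `μ_{k+4-d} ≤ λ_k` for all `k`. -/
def interlacedPairs (d : Fin 5) : Set (OrdinaryPartition × OrdinaryPartition) :=
  {p | (∀ k, p.1.parts (k + d) ≤ p.2.parts k) ∧ ∀ k, p.2.parts (k + (4 - d)) ≤ p.1.parts k}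

/-- The pairs of `interlacedPairs d` all of whose parts are at most `N`. -/
def boundedPairs (N : ℕ) (d : Fin 5) : Set (OrdinaryPartition × OrdinaryPartition) :=
  {p | p ∈ interlacedPairs d ∧ (∀ k, p.1.parts k ≤ N) ∧ ∀ k, p.2.parts k ≤ N}

/-- The distance of two elements of `Fin 5`. -/
abbrev gap (d e : Fin 5) : ℕ := ((d : ℕ) - e) + ((e : ℕ) - d)

/-- The shifts d, 4-d become y+d-x and x+4-d-y. They again add up to 4, and both being non-negative
is what puts the new one in `Fin 5`. -/
theorem prepend_mem_interlacedPairs_iff {N x y : ℕ} {d : Fin 5} {p p' : OrdinaryPartition}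
    (hp : ∀ k, p.parts k ≤ N) (hp' : ∀ k, p'.parts k ≤ N) :
    (prepend (N + 1) x p, prepend (N + 1) y p') ∈ interlacedPairs d ↔
      ∃ e : Fin 5, x + e = y + d ∧ (p, p') ∈ interlacedPairs e := by
  have hd := d.is_lt
  simp only [interlacedPairs, Set.mem_ofPred_eq, prepend_parts_shift_le_iff hp hp',
    prepend_parts_shift_le_iff hp' hp]
  constructor
  · rintro ⟨⟨h1, h2⟩, h3, h4⟩
    refine ⟨⟨y + d - x, by omega⟩, by simp only; omega, h2, fun k => ?_⟩
    convert h4 k using 3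
    simp only
    omega
  · rintro ⟨e, he, h1, h2⟩
    have := e.is_lt
    refine ⟨⟨by omega, fun k => ?_⟩, by omega, fun k => ?_⟩
    · convert h1 k using 3
      omega
    · convert h2 k using 3
      omega

/-- Removing the parts equal to `N + 1` from both partitions of a pair. -/
noncomputable def boundedPairsSuccEquiv (N : ℕ) (d : Fin 5) :
    (Σ e : Fin 5, ℕ × boundedPairs N e) ≃ boundedPairs (N + 1) d :=
  Equiv.ofBijective
    (fun z => ⟨(prepend (N + 1) (z.2.1 + (d - z.1 : ℕ)) z.2.2.1.1,
        prepend (N + 1) (z.2.1 + (z.1 - d : ℕ)) z.2.2.1.2),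
      (prepend_mem_interlacedPairs_iff z.2.2.2.2.1 z.2.2.2.2.2).2
        ⟨z.1, by omega, z.2.2.2.1⟩,
      prepend_le fun k => (z.2.2.2.2.1 k).trans N.le_succ,
      prepend_le fun k => (z.2.2.2.2.2 k).trans N.le_succ⟩) <| by
    constructor
    · rintro ⟨e, s, ⟨⟨p, p'⟩, he, hp, hp'⟩⟩ ⟨f, t, ⟨⟨r, r'⟩, hf, hr, hr'⟩⟩ h
      obtain ⟨h1, rfl⟩ := prepend_injective hp hr (congrArg (fun z => z.1.1) h)
      obtain ⟨h2, rfl⟩ := prepend_injective hp' hr' (congrArg (fun z => z.1.2) h)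
      simp only at h1 h2
      obtain rfl : e = f := Fin.ext (by omega)
      obtain rfl : s = t := by omega
      rfl
    · rintro ⟨⟨p, p'⟩, h, hp, hp'⟩
      obtain ⟨x, r, hr, rfl⟩ := exists_prepend_eq hp
      obtain ⟨y, r', hr', rfl⟩ := exists_prepend_eq hp'
      obtain ⟨e, he, hre⟩ := (prepend_mem_interlacedPairs_iff hr hr').1 h
      refine ⟨⟨e, x - (d - e : ℕ), ⟨(r, r'), hre, hr, hr'⟩⟩, Subtype.ext (Prod.ext ?_ ?_)⟩
      · simp only
        congr 1
        omega
      · simp only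
        congr 1
        omega

theorem size_boundedPairsSuccEquiv (N : ℕ) (d : Fin 5) (z : Σ e : Fin 5, ℕ × boundedPairs N e) :
    (boundedPairsSuccEquiv N d z).1.1.size + (boundedPairsSuccEquiv N d z).1.2.size =
      (N + 1) * gap d z.1 + 2 * (N + 1) * z.2.1 + (z.2.2.1.1.size + z.2.2.1.2.size) := by
  have h1 := size_prepend (N := N + 1) (z.2.1 + (d - z.1 : ℕ)) fun k => (z.2.2.2.2.1 k).trans N.le_succ
  have h2 := size_prepend (N := N + 1) (z.2.1 + (z.1 - d : ℕ)) fun k => (z.2.2.2.2.2 k).trans N.le_succ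
  refine (congrArg₂ (· + ·) h1 h2).trans ?_
  simp only [gap]
  ring

/-- The generating function of `boundedPairs N d`, by removing the largest parts. -/
noncomputable def pairSeries (q : ℂ) : ℕ → Fin 5 → ℂ
  | 0, _ => 1
  | N + 1, d => ∑ e, q ^ ((N + 1) * gap d e) * ((1 - q ^ (2 * (N + 1)))⁻¹ * pairSeries q N e)

theorem boundedPairs_zero (d : Fin 5) (p : boundedPairs 0 d) : p.1.1.size + p.1.2.size = 0 := by
  have h1 := p.1.1.size_eq_of_hasSum (fun k => Nat.le_zero.1 (p.2.2.1 k)) hasSum_zero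
  have h2 := p.1.2.size_eq_of_hasSum (fun k => Nat.le_zero.1 (p.2.2.2 k)) hasSum_zero
  omega

theorem boundedPairs_zero_unique (d : Fin 5) : Nonempty (Unique (boundedPairs 0 d)) := by
  refine ⟨⟨⟨(ofAntitone 0 (fun _ _ _ => le_rfl) ⟨0, rfl⟩,
    ofAntitone 0 (fun _ _ _ => le_rfl) ⟨0, rfl⟩), ⟨fun k => le_rfl, fun k => le_rfl⟩,
      fun k => le_rfl, fun k => le_rfl⟩⟩, ?_⟩
  rintro ⟨⟨p, p'⟩, h, hp, hp'⟩
  exact Subtype.ext (Prod.ext (ext_parts fun k => Nat.le_zero.1 (hp k))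
    (ext_parts fun k => Nat.le_zero.1 (hp' k)))

theorem hasSum_geometric_mul {β : Type*} {r a : ℂ} (hr : ‖r‖ < 1) {f : β → ℂ}
    (hf : Summable fun b => ‖f b‖) (h : HasSum f a) :
    HasSum (fun w : ℕ × β => r ^ w.1 * f w.2) ((1 - r)⁻¹ * a) := by
  have hg : Summable fun s : ℕ => ‖r ^ s‖ := by
    simpa only [norm_pow] using summable_geometric_of_lt_one (norm_nonneg _) hr
  exact (hasSum_geometric_of_norm_lt_one hr).mul h (summable_mul_of_summable_norm hg hf)

theorem hasSum_sigma_fintype {ι : Type*} [Fintype ι] {β : ι → Type*} {f : ∀ i, β i → ℂ}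
    {g : ι → ℂ} (hs : ∀ i, Summable fun b => ‖f i b‖) (h : ∀ i, HasSum (f i) (g i)) :
    Summable (fun z : Σ i, β i => ‖f z.1 z.2‖) ∧
      HasSum (fun z : Σ i, β i => f z.1 z.2) (∑ i, g i) := by
  have hsum : Summable (fun z : Σ i, β i => ‖f z.1 z.2‖) :=
    (summable_sigma_of_nonneg fun _ => norm_nonneg _).2 ⟨hs, Summable.of_finite⟩
  exact ⟨hsum, HasSum.sigma_of_hasSum (hasSum_fintype g) h hsum.of_norm⟩

/-- The common number of removed parts gives the geometric series in q^(2(N+1)). -/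
theorem hasSum_boundedPairs {q : ℂ} (hq : ‖q‖ < 1) (N : ℕ) (d : Fin 5) :
    Summable (fun p : boundedPairs N d => ‖q ^ (p.1.1.size + p.1.2.size)‖) ∧
      HasSum (fun p : boundedPairs N d => q ^ (p.1.1.size + p.1.2.size)) (pairSeries q N d) := by
  induction N generalizing d with
  | zero =>
    obtain ⟨_⟩ := boundedPairs_zero_unique d
    simp only [boundedPairs_zero, pow_zero]
    refine ⟨Summable.of_finite, ?_⟩
    simp [pairSeries]
  | succ N ih =>
    have hr : ‖q ^ (2 * (N + 1))‖ < 1 := by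
      rw [norm_pow]
      exact pow_lt_one₀ (norm_nonneg _) hq (by omega)
    have hf : ∀ z : Σ e : Fin 5, ℕ × boundedPairs N e,
        q ^ ((boundedPairsSuccEquiv N d z).1.1.size + (boundedPairsSuccEquiv N d z).1.2.size) =
          q ^ ((N + 1) * gap d z.1) * ((q ^ (2 * (N + 1))) ^ z.2.1 *
            q ^ (z.2.2.1.1.size + z.2.2.1.2.size)) := fun z => by
      rw [size_boundedPairsSuccEquiv, pow_add, pow_add, pow_mul _ (2 * (N + 1)), mul_assoc]
    have hg : Summable fun s : ℕ => ‖(q ^ (2 * (N + 1))) ^ s‖ := by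
      simpa only [norm_pow] using summable_geometric_of_lt_one (norm_nonneg _) hr
    have hsn : ∀ e : Fin 5, Summable fun w : ℕ × boundedPairs N e =>
        ‖q ^ ((N + 1) * gap d e) * ((q ^ (2 * (N + 1))) ^ w.1 *
            q ^ (w.2.1.1.size + w.2.1.2.size))‖ := fun e => by
      have := (hg.mul_norm (ih e).1).mul_left ‖q ^ ((N + 1) * gap d e)‖
      simpa only [norm_mul] using this
    rw [← (boundedPairsSuccEquiv N d).summable_iff, ← (boundedPairsSuccEquiv N d).hasSum_iff]
    simp only [Function.comp_def, hf, pairSeries]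
    exact hasSum_sigma_fintype (f := fun e (w : ℕ × boundedPairs N e) =>
      q ^ ((N + 1) * gap d e) * ((q ^ (2 * (N + 1))) ^ w.1 *
        q ^ (w.2.1.1.size + w.2.1.2.size))) hsn
      fun e => (hasSum_geometric_mul hr (ih e).1 (ih e).2).mul_left _

/-! ### Cylindric partitions as interlaced pairs -/

/-- The row `i` of the cylindric partition of profile `(2, 0, 0, 0)` that belongs to `(λ, μ)`:
the parts `λ_i, μ_i, λ_{i+4}, μ_{i+4}, …`. -/
noncomputable def cylindricRow {p : OrdinaryPartition × OrdinaryPartition}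
    (hp : p ∈ interlacedPairs 4) (i : Fin 4) : OrdinaryPartition :=
  ofAntitone (fun j => if j % 2 = 0 then p.1.parts (4 * (j / 2) + i)
      else p.2.parts (4 * (j / 2) + i))
    (antitone_nat_of_succ_le fun j => by
      rcases Nat.mod_two_eq_zero_or_one j with h | h
      · rw [if_neg (by omega), if_pos h, show (j + 1) / 2 = j / 2 by omega]
        exact hp.2 _
      · rw [if_pos (by omega), if_neg (by omega),
          show 4 * ((j + 1) / 2) + (i : ℕ) = 4 * (j / 2) + i + 4 by omega]
        exact hp.1 _)
    (by
      obtain ⟨n, hn⟩ := p.1.exists_parts_eq_zero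
      refine ⟨2 * n, ?_⟩
      rw [if_pos (by omega)]
      exact hn _ (by omega))

theorem cylindricRow_parts_even {p : OrdinaryPartition × OrdinaryPartition}
    (hp : p ∈ interlacedPairs 4) (i : Fin 4) (j : ℕ) :
    (cylindricRow hp i).parts (2 * j) = p.1.parts (4 * j + i) := by
  simp [cylindricRow]

theorem cylindricRow_parts_odd {p : OrdinaryPartition × OrdinaryPartition}
    (hp : p ∈ interlacedPairs 4) (i : Fin 4) (j : ℕ) :
    (cylindricRow hp i).parts (2 * j + 1) = p.2.parts (4 * j + i) := by
  simp [cylindricRow, show (2 * j + 1) / 2 = j by omega]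

theorem cylindricRow_row_le {p : OrdinaryPartition × OrdinaryPartition}
    (hp : p ∈ interlacedPairs 4) (i : Fin 4) (j : ℕ) :
    (cylindricRow hp (i + 1)).parts (j + (![2, 0, 0, 0] : Fin 4 → ℕ) (i + 1)) ≤
      (cylindricRow hp i).parts j := by
  rcases Nat.even_or_odd' j with ⟨m, rfl | rfl⟩
  -- Only the passage from the last row to the first has a shift. It is 2, so it preserves parity
  -- and moves one block of four along the strand.
  · have h : 2 * m + (![2, 0, 0, 0] : Fin 4 → ℕ) (i + 1) = 2 * (m + if i = 3 then 1 else 0) := by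
      fin_cases i <;> simp
      rfl
    rw [h, cylindricRow_parts_even, cylindricRow_parts_even]
    apply p.1.antitone_parts
    fin_cases i <;> simp
    omega
  · have h : 2 * m + 1 + (![2, 0, 0, 0] : Fin 4 → ℕ) (i + 1) =
        2 * (m + if i = 3 then 1 else 0) + 1 := by
      fin_cases i <;> simp
      rfl
    rw [h, cylindricRow_parts_odd, cylindricRow_parts_odd]
    apply p.2.antitone_parts
    fin_cases i <;> simp
    omega

/-- The sequence that runs through the entries `e, e + 2, e + 4, …` of the four rows in turn. -/
noncomputable def cylindricStrand (Λ : CylindricPartition (![2, 0, 0, 0] : Fin 4 → ℕ)) (e : ℕ) :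
    OrdinaryPartition :=
  ofAntitone (fun k => (Λ.row (Fin.ofNat 4 k)).parts (2 * (k / 4) + e))
    (antitone_nat_of_succ_le fun k => by
      have h := Λ.row_le (Fin.ofNat 4 k) (2 * (k / 4) + e)
      have h1 : Fin.ofNat 4 k + 1 = Fin.ofNat 4 (k + 1) := by
        apply Fin.ext
        simp [Fin.ofNat, Fin.add_def]
      have h2 : (![2, 0, 0, 0] : Fin 4 → ℕ) (Fin.ofNat 4 (k + 1)) + 2 * (k / 4) =
          2 * ((k + 1) / 4) := by
        obtain ⟨m, i, rfl⟩ : ∃ (m : ℕ) (i : Fin 4), k = 4 * m + i :=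
          ⟨k / 4, Fin.ofNat 4 k, by simp [Fin.ofNat]; omega⟩
        have h3 : Fin.ofNat 4 (4 * m + i + 1) = i + 1 := by
          apply Fin.ext
          simp [Fin.ofNat, Fin.add_def, add_assoc]
        rw [h3]
        fin_cases i <;> simp <;> omega
      rw [h1] at h
      exact (le_of_eq (congrArg _ (by omega))).trans h)
    (by
      obtain ⟨n, hn⟩ := (Λ.row 0).exists_parts_eq_zero
      refine ⟨4 * n, ?_⟩
      have : Fin.ofNat 4 (4 * n) = 0 := Fin.ext (by simp [Fin.ofNat])
      rw [this]
      exact hn _ (by omega))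

theorem cylindricStrand_parts (Λ : CylindricPartition (![2, 0, 0, 0] : Fin 4 → ℕ)) (e m : ℕ)
    (i : Fin 4) : (cylindricStrand Λ e).parts (4 * m + i) = (Λ.row i).parts (2 * m + e) := by
  have h : Fin.ofNat 4 (4 * m + i) = i := Fin.ext (by simp [Fin.ofNat])
  rw [cylindricStrand, ofAntitone_parts, h, show (4 * m + (i : ℕ)) / 4 = m by omega]

theorem ext_parts_four {p p' : OrdinaryPartition}
    (h : ∀ (m : ℕ) (i : Fin 4), p.parts (4 * m + i) = p'.parts (4 * m + i)) : p = p' := by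
  refine ext_parts fun k => ?_
  have := h (k / 4) ⟨k % 4, Nat.mod_lt _ (by omega)⟩
  rwa [Nat.div_add_mod] at this

/-- Cylindric partitions of profile `(2, 0, 0, 0)` as interlaced pairs of partitions. -/
noncomputable def cylindricEquiv :
    interlacedPairs 4 ≃ CylindricPartition (![2, 0, 0, 0] : Fin 4 → ℕ) where
  toFun p := ⟨cylindricRow p.2, cylindricRow_row_le p.2⟩
  invFun Λ := ⟨(cylindricStrand Λ 0, cylindricStrand Λ 1), by
    constructor
    -- Four steps along a strand lead back to the same row, two places further: entry 2m+2 is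
    -- compared with entry 2m+1.
    · intro k
      obtain ⟨m, i, rfl⟩ : ∃ (m : ℕ) (i : Fin 4), k = 4 * m + i :=
        ⟨k / 4, ⟨k % 4, Nat.mod_lt _ (by omega)⟩, (Nat.div_add_mod _ _).symm⟩
      have : 4 * m + (i : ℕ) + (4 : Fin 5) = 4 * (m + 1) + i := by
        change _ + 4 = _
        ring
      simp only [this, cylindricStrand_parts]
      exact (Λ.row i).antitone_parts (by omega)
    · exact fun k => (Λ.row _).antitone_parts (by
        change _ ≤ 2 * (k / 4) + 1
        omega)⟩
  left_inv p := by
    refine Subtype.ext (Prod.ext (ext_parts_four fun m i => ?_) (ext_parts_four fun m i => ?_))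
    · simp only [cylindricStrand_parts]
      exact cylindricRow_parts_even _ _ _
    · simp only [cylindricStrand_parts]
      exact cylindricRow_parts_odd _ _ _
  right_inv Λ := by
    refine CylindricPartition.ext (funext fun i => ext_parts fun j => ?_)
    rcases Nat.even_or_odd' j with ⟨m, rfl | rfl⟩
    · simp only [cylindricRow_parts_even, cylindricStrand_parts, add_zero]
    · simp only [cylindricRow_parts_odd, cylindricStrand_parts]

theorem OrdinaryPartition.summable_parts (p : OrdinaryPartition) (a b : ℕ) :
    Summable fun j => p.parts ((a + 1) * j + b) := by
  refine summable_of_hasFiniteSupport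
    ((p.parts.hasFiniteSupport.preimage (f := fun j => (a + 1) * j + b) ?_).subset fun j hj => hj)
  exact fun j _ l _ h => Nat.eq_of_mul_eq_mul_left a.succ_pos (Nat.add_right_cancel h)

theorem OrdinaryPartition.size_eq_sum_four (p : OrdinaryPartition) :
    p.size = ∑ i : Fin 4, ∑' j, p.parts (4 * j + i) := by
  have h (b : ℕ) := (p.summable_parts 3 b).hasSum
  have h0 : HasSum (fun k => p.parts (2 * k)) _ := HasSum.even_add_odd
    (by convert h 0 using 3; ring) (by convert h 2 using 3; ring)
  have h1 : HasSum (fun k => p.parts (2 * k + 1)) _ := HasSum.even_add_odd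
    (by convert h 1 using 3; ring) (by convert h 3 using 3; ring)
  rw [p.hasSum_parts.unique (h0.even_add_odd h1), Fin.sum_univ_four]
  simp only [Nat.reduceAdd]
  change _ = _ + tsum (fun j => p.parts (4 * j + 1)) + tsum (fun j => p.parts (4 * j + 2)) +
    tsum (fun j => p.parts (4 * j + 3))
  simp only [Fin.val_zero]
  ring

theorem size_cylindricEquiv (p : interlacedPairs 4) :
    (cylindricEquiv p).size = p.1.1.size + p.1.2.size := by
  rw [CylindricPartition.size, OrdinaryPartition.size_eq_sum_four,
    OrdinaryPartition.size_eq_sum_four, ← Finset.sum_add_distrib]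
  refine Finset.sum_congr rfl fun i _ => ?_
  refine (hasSum_parts _).unique (HasSum.even_add_odd ?_ ?_)
  · simpa only [cylindricEquiv, Equiv.coe_fn_mk, cylindricRow_parts_even] using
      (p.1.1.summable_parts 3 i).hasSum
  · simpa only [cylindricEquiv, Equiv.coe_fn_mk, cylindricRow_parts_odd] using
      (p.1.2.summable_parts 3 i).hasSum

/-! ### Removing the bound on the parts -/

/-- A sum over the union of an increasing sequence of sets, from the sums over the sets. -/
theorem hasSum_of_tendsto_subtype {β : Type*} {f : β → ℂ} {s : ℕ → Set β} (hs : Monotone s)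
    (hU : ∀ b, ∃ N, b ∈ s N) (hf : ∀ N, Summable fun b : s N => ‖f b‖) {c : ℝ}
    (hc : ∀ N, ∑' b : s N, ‖f b‖ ≤ c) {a : ℂ}
    (ha : Tendsto (fun N => ∑' b : s N, f b) atTop (𝓝 a)) : HasSum f a := by
  have hsum : Summable fun b => ‖f b‖ := by
    refine summable_of_sum_le (c := c) (fun b => norm_nonneg _) fun u => ?_
    obtain ⟨N, hN⟩ : ∃ N, ∀ b ∈ u, b ∈ s N := by
      choose g hg using hU
      exact ⟨u.sup g, fun b hb => hs (Finset.le_sup hb) (hg b)⟩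
    refine le_trans ?_ (hc N)
    rw [tsum_subtype (s N) fun b => ‖f b‖, ← Finset.sum_congr rfl fun b hb =>
      Set.indicator_of_mem (hN b hb) fun b => ‖f b‖]
    exact (summable_subtype_iff_indicator.1 (hf N)).sum_le_tsum u
      fun b _ => Set.indicator_nonneg (fun _ _ => norm_nonneg _) _
  have h := tendsto_tsum_of_dominated_convergence (𝓕 := atTop)
    (f := fun N b => (s N).indicator f b) (g := f) hsum
    (fun b => by
      obtain ⟨N, hN⟩ := hU b
      refine tendsto_const_nhds.congr' ?_
      filter_upwards [eventually_ge_atTop N] with M hM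
      exact (Set.indicator_of_mem (hs hM hN) f).symm)
    (Eventually.of_forall fun N b => norm_indicator_le_norm_self f b)
  simp only [← tsum_subtype] at h
  rw [← tendsto_nhds_unique h ha]
  exact hsum.of_norm.hasSum

theorem boundedPairs_mono (d : Fin 5) : Monotone fun N => boundedPairs N d :=
  fun _ _ h _ hp => ⟨hp.1, fun k => (hp.2.1 k).trans h, fun k => (hp.2.2 k).trans h⟩

/-- The sums of norms are the values of the same generating functions at ‖q‖, so convergence there
supplies the uniform bound. -/
theorem hasSum_cylindric_of_tendsto {q : ℂ} (hq : ‖q‖ < 1) {a b : ℂ}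
    (ha : Tendsto (fun N => pairSeries q N 4) atTop (𝓝 a))
    (hb : Tendsto (fun N => pairSeries (‖q‖ : ℂ) N 4) atTop (𝓝 b)) :
    HasSum (fun Λ : CylindricPartition (![2, 0, 0, 0] : Fin 4 → ℕ) => q ^ Λ.size) a := by
  rw [← cylindricEquiv.hasSum_iff]
  simp only [Function.comp_def, size_cylindricEquiv]
  let e (N : ℕ) : {p : interlacedPairs 4 | p.1 ∈ boundedPairs N 4} ≃ boundedPairs N 4 :=
    Equiv.subtypeSubtypeEquivSubtype (p := (· ∈ interlacedPairs 4)) (q := (· ∈ boundedPairs N 4))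
      fun h => h.1
  obtain ⟨c, hc⟩ := hb.norm.bddAbove_range
  refine hasSum_of_tendsto_subtype (s := fun N => {p | p.1 ∈ boundedPairs N 4}) (c := c)
    (fun N M h p hp => boundedPairs_mono 4 h hp) (fun p => ?_) (fun N => ?_) (fun N => ?_)
    (ha.congr fun N => ?_)
  · exact ⟨max (p.1.1.parts 0) (p.1.2.parts 0), p.2,
      fun k => le_max_of_le_left (p.1.1.antitone_parts k.zero_le),
      fun k => le_max_of_le_right (p.1.2.antitone_parts k.zero_le)⟩
  · exact ((e N).summable_iff (f := fun p : boundedPairs N 4 =>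
      ‖q ^ (p.1.1.size + p.1.2.size)‖)).2 (hasSum_boundedPairs hq N 4).1
  · refine le_trans (le_of_eq ?_) (hc ⟨N, rfl⟩)
    have h1 := (hasSum_boundedPairs (q := (‖q‖ : ℂ)) (by simpa using hq) N 4).2
    have h2 : ((∑' p : boundedPairs N 4, ‖q ^ (p.1.1.size + p.1.2.size)‖ : ℝ) : ℂ) =
        pairSeries ‖q‖ N 4 := by
      rw [Complex.ofReal_tsum, ← h1.tsum_eq]
      simp only [norm_pow, Complex.ofReal_pow]
    beta_reduce
    rw [← h2, Complex.norm_of_nonneg (tsum_nonneg fun _ => norm_nonneg _)]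
    exact (e N).tsum_eq fun p => ‖q ^ (p.1.1.size + p.1.2.size)‖
  · rw [← (hasSum_boundedPairs hq N 4).2.tsum_eq]
    exact ((e N).tsum_eq fun p => q ^ (p.1.1.size + p.1.2.size)).symm

/-! ### q-Pochhammer symbols and q-binomial series -/

open PowerSeries in
/-- The `q`-binomial series `∑ (a; q)_n / (q; q)_n (x X)^n`. -/
noncomputable def qBinomialSeries (a q x : ℂ) : PowerSeries ℂ :=
  mk fun n => x ^ n * qPochhammer a q n / qPochhammer q q n

theorem one_sub_ne_zero_of_norm_lt_one {x : ℂ} (hx : ‖x‖ < 1) : 1 - x ≠ 0 := fun h => by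
  rw [← sub_eq_zero.1 h, norm_one] at hx
  exact lt_irrefl _ hx

theorem qPochhammer_succ (a q : ℂ) (n : ℕ) :
    qPochhammer a q (n + 1) = qPochhammer a q n * (1 - a * q ^ n) :=
  Finset.prod_range_succ _ _

@[simp]
theorem qPochhammer_zero (a q : ℂ) : qPochhammer a q 0 = 1 := rfl

@[simp]
theorem qPochhammer_zero_left (q : ℂ) (n : ℕ) : qPochhammer 0 q n = 1 := by
  simp [qPochhammer]

theorem norm_mul_pow_lt_one {a q : ℂ} (ha : ‖a‖ < 1) (hq : ‖q‖ < 1) (n : ℕ) :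
    ‖a * q ^ n‖ < 1 := by
  rw [norm_mul, norm_pow]
  exact mul_lt_one_of_nonneg_of_lt_one_left (norm_nonneg _) ha
    (pow_le_one₀ (norm_nonneg _) hq.le)

theorem qPochhammer_ne_zero {a q : ℂ} (ha : ‖a‖ < 1) (hq : ‖q‖ < 1) (n : ℕ) :
    qPochhammer a q n ≠ 0 :=
  Finset.prod_ne_zero_iff.2 fun k _ => one_sub_ne_zero_of_norm_lt_one (norm_mul_pow_lt_one ha hq k)

theorem qPochhammer_add (a q : ℂ) (m n : ℕ) :
    qPochhammer a q (m + n) = qPochhammer a q m * qPochhammer (a * q ^ m) q n := by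
  simp only [qPochhammer, Finset.prod_range_add, pow_add, mul_assoc]

theorem qPochhammerInf_eq_mul (a : ℂ) {q : ℂ} (hq : ‖q‖ < 1) (m : ℕ) :
    qPochhammerInf a q = qPochhammer a q m * qPochhammerInf (a * q ^ m) q := by
  have h := (tendsto_qPochhammer (a * q ^ m) q hq).const_mul (qPochhammer a q m)
  simp only [← qPochhammer_add, add_comm m] at h
  exact tendsto_nhds_unique ((tendsto_add_atTop_iff_nat m).2 (tendsto_qPochhammer a q hq)) h

theorem qPochhammerInf_ne_zero {a q : ℂ} (ha : ‖a‖ < 1) (hq : ‖q‖ < 1) :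
    qPochhammerInf a q ≠ 0 := by
  have hs : Summable fun k : ℕ => ‖-(a * q ^ k)‖ := by
    simp only [norm_neg, norm_mul, norm_pow]
    exact (summable_geometric_of_lt_one (norm_nonneg q) hq).mul_left ‖a‖
  have h := (multipliable_one_add_of_summable hs).hasProd.tendsto_prod_nat
  have he : (fun n => ∏ k ∈ Finset.range n, (1 + -(a * q ^ k))) = qPochhammer a q := by
    funext n
    simp only [qPochhammer, sub_eq_add_neg]
  rw [he] at h
  rw [tendsto_nhds_unique (tendsto_qPochhammer a q hq) h]
  refine tprod_one_add_ne_zero_of_summable (fun k => ?_) hs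
  rw [← sub_eq_add_neg]
  exact one_sub_ne_zero_of_norm_lt_one (norm_mul_pow_lt_one ha hq k)

theorem exists_norm_qPochhammer_le (a : ℂ) {q : ℂ} (hq : ‖q‖ < 1) :
    ∃ K, ∀ n, ‖qPochhammer a q n‖ ≤ K := by
  obtain ⟨K, hK⟩ := (tendsto_qPochhammer a q hq).norm.bddAbove_range
  exact ⟨K, fun n => hK ⟨n, rfl⟩⟩

theorem exists_norm_inv_qPochhammer_le {a q : ℂ} (ha : ‖a‖ < 1) (hq : ‖q‖ < 1) :
    ∃ K, ∀ n, ‖(qPochhammer a q n)⁻¹‖ ≤ K := by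
  obtain ⟨K, hK⟩ :=
    ((tendsto_qPochhammer a q hq).inv₀ (qPochhammerInf_ne_zero ha hq)).norm.bddAbove_range
  exact ⟨K, fun n => hK ⟨n, rfl⟩⟩

section

open PowerSeries

/-- By the q-binomial theorem the series is (axX;q)_∞/(xX;q)_∞; this equation replaces the product
formula. -/
theorem qBinomialSeries_functional_equation (a x : ℂ) {q : ℂ} (hq : ‖q‖ < 1) :
    (1 - C x * X) * qBinomialSeries a q x =
      (1 - C (a * x) * X) * rescale q (qBinomialSeries a q x) := by
  ext n
  cases n with
  | zero =>
    simp only [sub_mul, one_mul, map_sub, mul_assoc, coeff_C_mul, coeff_zero_X_mul, coeff_rescale,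
      pow_zero, mul_zero]
  | succ n =>
    have h1 := one_sub_ne_zero_of_norm_lt_one (norm_mul_pow_lt_one hq hq n)
    have h2 := qPochhammer_ne_zero hq hq n
    simp only [sub_mul, one_mul, map_sub, mul_assoc, coeff_C_mul, coeff_succ_X_mul, coeff_rescale,
      qBinomialSeries, coeff_mk, qPochhammer_succ, pow_succ]
    generalize q ^ n = u at *
    have h3 : 1 - u * q ≠ 0 := by rwa [mul_comm]
    field_simp
    ring

/-! ### Solution of the q-difference equations -/

/-- The product of two `q`-binomial series that solves the functional equations of
the generating functions of cylindric partitions of rank four and level two. -/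
noncomputable def levelTwoSeries (q : ℂ) : PowerSeries ℂ :=
  qBinomialSeries (-q ^ 2) (q ^ 2) 1 * qBinomialSeries 0 (q ^ 2) q

theorem norm_sq_lt_one {q : ℂ} (hq : ‖q‖ < 1) : ‖q ^ 2‖ < 1 := by
  rw [norm_pow]
  exact pow_lt_one₀ (norm_nonneg _) hq two_ne_zero

theorem levelTwoSeries_functional_equation {q : ℂ} (hq : ‖q‖ < 1) :
    (1 - C q * X) * ((1 - X) * levelTwoSeries q) =
      (1 + C (q ^ 2) * X) * rescale (q ^ 2) (levelTwoSeries q) := by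
  have h1 := qBinomialSeries_functional_equation (-q ^ 2) 1 (norm_sq_lt_one hq)
  have h2 := qBinomialSeries_functional_equation 0 q (norm_sq_lt_one hq)
  simp only [map_one, one_mul, mul_one, map_neg, zero_mul, map_zero, sub_zero] at h1 h2
  rw [levelTwoSeries, map_mul, ← h2]
  linear_combination (1 - C q * X) * qBinomialSeries 0 (q ^ 2) q * h1

theorem levelTwoSeries_recurrence {q : ℂ} (hq : ‖q‖ < 1) (n : ℕ) :
    (1 + q ^ (2 * (n + 1))) * coeff (n + 1) ((1 - X) * levelTwoSeries q) =
      2 * q ^ (2 * (n + 1)) * coeff (n + 1) (levelTwoSeries q) +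
        q * coeff n ((1 - X) * levelTwoSeries q) := by
  have h := congrArg (coeff (n + 1)) (levelTwoSeries_functional_equation hq)
  have h1 : coeff (n + 1) ((1 - X) * levelTwoSeries q) =
      coeff (n + 1) (levelTwoSeries q) - coeff n (levelTwoSeries q) := by
    simp [sub_mul, coeff_succ_X_mul]
  rw [sub_mul, add_mul, one_mul, one_mul, mul_assoc, mul_assoc, map_sub, map_add, coeff_C_mul,
    coeff_C_mul, coeff_succ_X_mul, coeff_succ_X_mul, coeff_rescale, coeff_rescale] at h
  linear_combination h + q ^ (2 * (n + 1)) * h1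

/-- The normalised generating function for the profile `(2, 0, 0, 0)`. -/
noncomputable def seriesA (q : ℂ) : PowerSeries ℂ :=
  mk fun n => q ^ (n * (n + 1)) * coeff n (levelTwoSeries q)

/-- The normalised generating function for the profile `(1, 1, 0, 0)`. -/
noncomputable def seriesB (q : ℂ) : PowerSeries ℂ :=
  mk fun n => q ^ (n * n) * coeff n (levelTwoSeries q)

/-- The normalised generating function for the profile `(1, 0, 1, 0)`. -/
noncomputable def seriesC (q : ℂ) : PowerSeries ℂ :=
  -- The truncation of n - 1 at n = 0 is harmless because of the factor n.
  mk fun n => q ^ (n * (n - 1)) * coeff n ((1 - X) * levelTwoSeries q)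

theorem seriesA_eq (q : ℂ) : seriesA q = rescale q (seriesB q) := by
  ext n
  simp only [seriesA, seriesB, coeff_mk, coeff_rescale]
  ring

/-- This depends only on the chosen powers of q; the functional equation of `levelTwoSeries` enters
in `seriesC_eq` alone. -/
theorem seriesB_eq (q : ℂ) :
    seriesB q = rescale q (seriesC q) + C q * X * rescale (q ^ 2) (seriesB q) := by
  ext n
  rw [mul_assoc, map_add, coeff_C_mul]
  cases n with
  | zero => simp [seriesB, seriesC]
  | succ n =>
    rw [coeff_succ_X_mul, coeff_rescale, coeff_rescale]
    simp only [seriesB, seriesC, coeff_mk, sub_mul, one_mul, map_sub, coeff_succ_X_mul,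
      Nat.add_sub_cancel]
    ring

theorem seriesC_eq {q : ℂ} (hq : ‖q‖ < 1) :
    seriesC q + (1 - C q * X) * rescale (q ^ 2) (seriesC q) = 2 * rescale q (seriesB q) := by
  ext n
  rw [sub_mul, one_mul, mul_assoc, map_add, map_sub, coeff_C_mul, two_mul, map_add]
  cases n with
  | zero => simp [seriesB, seriesC]
  | succ n =>
    have h := levelTwoSeries_recurrence hq n
    rw [coeff_succ_X_mul, coeff_rescale, coeff_rescale, coeff_rescale]
    simp only [seriesB, seriesC, coeff_mk, Nat.add_sub_cancel]
    have h2 : q * ((q ^ 2) ^ n * (q ^ (n * (n - 1)) * coeff n ((1 - X) * levelTwoSeries q))) =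
        q ^ ((n + 1) * n) * (q * coeff n ((1 - X) * levelTwoSeries q)) := by
      have h3 : (n + 1) * n = 2 * n + n * (n - 1) := by
        cases n <;> simp
        ring
      rw [h3]
      ring
    rw [h2]
    linear_combination q ^ ((n + 1) * n) * h

/-! ### Identification with the generating functions of bounded pairs -/

/-- The generating function `∑ F_N X^N` that belongs to a normalised generating function. -/
noncomputable def levelTotal (q : ℂ) (φ : PowerSeries ℂ) : PowerSeries ℂ :=
  φ * qBinomialSeries 0 q 1

theorem rescale_euler {q : ℂ} (hq : ‖q‖ < 1) :
    rescale q (qBinomialSeries 0 q 1) = (1 - X) * qBinomialSeries 0 q 1 := by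
  simpa using (qBinomialSeries_functional_equation 0 1 hq).symm

theorem rescale_sq_euler {q : ℂ} (hq : ‖q‖ < 1) :
    rescale (q ^ 2) (qBinomialSeries 0 q 1) =
      (1 - C q * X) * ((1 - X) * qBinomialSeries 0 q 1) := by
  rw [sq, rescale_mul, RingHom.comp_apply, rescale_euler hq, map_mul, rescale_euler hq]
  simp [rescale_X]

theorem coeff_succ_one_sub_X_mul (φ : PowerSeries ℂ) (n : ℕ) :
    coeff (n + 1) ((1 - X) * φ) = coeff (n + 1) φ - coeff n φ := by
  simp [sub_mul, coeff_succ_X_mul]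

/-- With t = q^(n+1), this and the next two steps are the rows of the tridiagonal inverse of
t^|d-e|/(1-t²), folded by the symmetry d ↔ 4-d. -/
theorem levelTotal_seriesA_step {q : ℂ} (hq : ‖q‖ < 1) (n : ℕ) :
    coeff n (levelTotal q (seriesA q)) = coeff (n + 1) (levelTotal q (seriesA q)) -
      q ^ (n + 1) * coeff (n + 1) (levelTotal q (seriesB q)) := by
  have h : (1 - X) * levelTotal q (seriesA q) = rescale q (levelTotal q (seriesB q)) := by
    rw [levelTotal, levelTotal, map_mul, rescale_euler hq, seriesA_eq]
    ring
  have h2 := congrArg (coeff (n + 1)) h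
  rw [coeff_succ_one_sub_X_mul, coeff_rescale] at h2
  linear_combination (-1 : ℂ) * h2

theorem levelTotal_seriesB_step {q : ℂ} (hq : ‖q‖ < 1) (n : ℕ) :
    coeff n (levelTotal q (seriesB q)) =
      (1 + q ^ (2 * (n + 1))) * coeff (n + 1) (levelTotal q (seriesB q)) -
      q ^ (n + 1) * (coeff (n + 1) (levelTotal q (seriesA q)) +
        coeff (n + 1) (levelTotal q (seriesC q))) := by
  have h : (1 - X) * levelTotal q (seriesB q) = rescale q (levelTotal q (seriesA q)) +
      rescale q (levelTotal q (seriesC q)) - rescale (q ^ 2) (levelTotal q (seriesB q)) := by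
    have hA : rescale q (seriesA q) = rescale (q ^ 2) (seriesB q) := by
      rw [seriesA_eq, sq, rescale_mul, RingHom.comp_apply]
    simp only [levelTotal, map_mul, rescale_euler hq, rescale_sq_euler hq, hA]
    linear_combination (1 - X) * qBinomialSeries 0 q 1 * seriesB_eq q
  have h2 := congrArg (coeff (n + 1)) h
  rw [coeff_succ_one_sub_X_mul, map_sub, map_add, coeff_rescale, coeff_rescale,
    coeff_rescale] at h2
  linear_combination (-1 : ℂ) * h2

theorem levelTotal_seriesC_step {q : ℂ} (hq : ‖q‖ < 1) (n : ℕ) :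
    coeff n (levelTotal q (seriesC q)) =
      (1 + q ^ (2 * (n + 1))) * coeff (n + 1) (levelTotal q (seriesC q)) -
      2 * q ^ (n + 1) * coeff (n + 1) (levelTotal q (seriesB q)) := by
  have h : (1 - X) * levelTotal q (seriesC q) = 2 * rescale q (levelTotal q (seriesB q)) -
      rescale (q ^ 2) (levelTotal q (seriesC q)) := by
    simp only [levelTotal, map_mul, rescale_euler hq, rescale_sq_euler hq]
    linear_combination (1 - X) * qBinomialSeries 0 q 1 * seriesC_eq hq
  have h2 := congrArg (coeff (n + 1)) h
  rw [coeff_succ_one_sub_X_mul, two_mul, map_sub, map_add, coeff_rescale, coeff_rescale] at h2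
  linear_combination (-1 : ℂ) * h2

theorem pairSeries_eq {q : ℂ} (hq : ‖q‖ < 1) (N : ℕ) :
    pairSeries q N = ![coeff N (levelTotal q (seriesA q)), coeff N (levelTotal q (seriesB q)),
      coeff N (levelTotal q (seriesC q)), coeff N (levelTotal q (seriesB q)),
      coeff N (levelTotal q (seriesA q))] := by
  induction N with
  | zero =>
    funext d
    fin_cases d <;>
      simp [pairSeries, levelTotal, seriesA, seriesB, seriesC, levelTwoSeries, qBinomialSeries]
  | succ N ih =>
    have ht : 1 - q ^ (2 * (N + 1)) ≠ 0 := by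
      refine one_sub_ne_zero_of_norm_lt_one ?_
      rw [norm_pow]
      exact pow_lt_one₀ (norm_nonneg _) hq (by omega)
    have hA := levelTotal_seriesA_step hq N
    have hB := levelTotal_seriesB_step hq N
    have hC := levelTotal_seriesC_step hq N
    have hp : q ^ (2 * (N + 1)) = (q ^ (N + 1)) ^ 2 := pow_mul' _ _ _
    rw [hp] at ht hB hC
    funext d
    rw [pairSeries, ih, hp]
    generalize hq' : q ^ (N + 1) = t at *
    fin_cases d <;> simp [Fin.sum_univ_five, gap, pow_mul, hq', hA, hB, hC] <;>
      field_simp <;> ring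

end

/-! ### Euler's identity and the limit N → ∞ -/

/-- Euler's expansion of the infinite product `(-y; q)_∞`. -/
theorem hasSum_euler {q y : ℂ} (hq : ‖q‖ < 1) (hy : ‖y‖ < 1) :
    HasSum (fun k => q ^ k.choose 2 * y ^ k * (qPochhammer q q k)⁻¹) (qPochhammerInf (-y) q) := by
  obtain ⟨K, hK⟩ := exists_norm_inv_qPochhammer_le hq hq
  have hbound (x : ℂ) (hx : ‖x‖ ≤ ‖y‖) (k : ℕ) :
      ‖q ^ k.choose 2 * x ^ k * (qPochhammer q q k)⁻¹‖ ≤ ‖y‖ ^ k * K := by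
    rw [norm_mul, norm_mul, norm_pow, norm_pow]
    refine mul_le_mul ?_ (hK k) (norm_nonneg _) (by positivity)
    exact (mul_le_of_le_one_left (by positivity) (pow_le_one₀ (norm_nonneg _) hq.le)).trans
      (pow_le_pow_left₀ (norm_nonneg _) hx k)
  have hg : Summable fun k => ‖y‖ ^ k * K :=
    (summable_geometric_of_lt_one (norm_nonneg _) hy).mul_right K
  have hsum (x : ℂ) (hx : ‖x‖ ≤ ‖y‖) :
      Summable fun k => q ^ k.choose 2 * x ^ k * (qPochhammer q q k)⁻¹ :=
    hg.of_norm_bounded (hbound x hx)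
  have hle (x : ℂ) (hx : ‖x‖ ≤ ‖y‖) : ‖x * q‖ ≤ ‖y‖ := by
    rw [norm_mul]
    exact (mul_le_of_le_one_right (norm_nonneg _) hq.le).trans hx
  let S (x : ℂ) : ℂ := ∑' k, q ^ k.choose 2 * x ^ k * (qPochhammer q q k)⁻¹
  -- In S(x) - S(xq) the term k = 0 vanishes, and the factor 1 - q^(k+1) of the next one cancels the
  -- last factor of (q;q)_{k+1}, leaving x S(xq).
  have hS (x : ℂ) (hx : ‖x‖ ≤ ‖y‖) : S x = (1 + x) * S (x * q) := by
    have h1 := (hsum x hx).hasSum.sub (hsum _ (hle x hx)).hasSum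
    rw [← hasSum_nat_add_iff' 1] at h1
    have h2 := (hsum _ (hle x hx)).hasSum.mul_left x
    have h3 := h1.unique (h2.congr_fun ?_)
    · simp only [Finset.sum_range_one, pow_zero, sub_self, sub_zero] at h3
      linear_combination h3
    · intro k
      have h4 := qPochhammer_ne_zero hq hq k
      have h5 := one_sub_ne_zero_of_norm_lt_one (norm_mul_pow_lt_one hq hq k)
      have h6 : (k + 1).choose 2 = k.choose 2 + k := by
        rw [Nat.choose_succ_succ' k 1, Nat.choose_one_right, add_comm]
      rw [qPochhammer_succ, h6, mul_pow, mul_pow, pow_add, pow_succ x, pow_succ q]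
      generalize q ^ k = u at *
      have h7 : 1 - u * q ≠ 0 := by rwa [mul_comm]
      field_simp
  have hiter (n : ℕ) : ‖y * q ^ n‖ ≤ ‖y‖ ∧ S y = qPochhammer (-y) q n * S (y * q ^ n) := by
    induction n with
    | zero => simp
    | succ n ih =>
      have h := hle _ ih.1
      rw [mul_assoc, ← pow_succ] at h
      refine ⟨h, ?_⟩
      rw [ih.2, hS _ ih.1, qPochhammer_succ, mul_assoc y, ← pow_succ]
      ring
  have hlim : Tendsto (fun n => S (y * q ^ n)) atTop (𝓝 1) := by
    have h := tendsto_tsum_of_dominated_convergence (𝓕 := atTop)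
      (f := fun n k => q ^ k.choose 2 * (y * q ^ n) ^ k * (qPochhammer q q k)⁻¹)
      (g := fun k => if k = 0 then (1 : ℂ) else 0) hg (fun k => ?_)
      (Eventually.of_forall fun n k => hbound _ (hiter n).1 k)
    · simpa only [tsum_ite_eq] using h
    · have h0 : Tendsto (fun n => y * q ^ n) atTop (𝓝 0) := by
        simpa using (tendsto_pow_atTop_nhds_zero_of_norm_lt_one hq).const_mul y
      have h1 := ((h0.pow k).const_mul (q ^ k.choose 2)).mul_const (qPochhammer q q k)⁻¹
      convert h1 using 2
      rcases k.eq_zero_or_pos with rfl | hk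
      · simp
      · simp [hk.ne']
  have hfin : S y = qPochhammerInf (-y) q := by
    have h := (tendsto_qPochhammer (-y) q hq).mul hlim
    simp only [← (hiter _).2, mul_one] at h
    exact tendsto_nhds_unique tendsto_const_nhds h
  rw [← hfin]
  exact (hsum y le_rfl).hasSum

section

open PowerSeries

/-- The coefficient is ∑_{n ≤ N} φ_n/(q;q)_{N-n}. Since the reciprocals 1/(q;q)_j are bounded,
dominated convergence applies. -/
theorem tendsto_coeff_levelTotal {q : ℂ} (hq : ‖q‖ < 1) {φ : PowerSeries ℂ}
    (hφ : Summable fun n => ‖coeff n φ‖) :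
    Tendsto (fun N => coeff N (levelTotal q φ)) atTop
      (𝓝 ((∑' n, coeff n φ) * (qPochhammerInf q q)⁻¹)) := by
  obtain ⟨K, hK⟩ := exists_norm_inv_qPochhammer_le hq hq
  have hK0 : 0 ≤ K := (norm_nonneg _).trans (hK 0)
  have h := tendsto_tsum_of_dominated_convergence (𝓕 := atTop)
    (f := fun N n => if n ≤ N then coeff n φ * (qPochhammer q q (N - n))⁻¹ else 0)
    (g := fun n => coeff n φ * (qPochhammerInf q q)⁻¹) (hφ.mul_right K) (fun n => ?_)
    (Eventually.of_forall fun N n => ?_)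
  · rw [tsum_mul_right] at h
    refine h.congr fun N => ?_
    rw [levelTotal, coeff_mul, Finset.Nat.sum_antidiagonal_eq_sum_range_succ
      fun i j => coeff i φ * coeff j (qBinomialSeries 0 q 1),
      tsum_eq_sum (s := Finset.range (N + 1)) fun n hn => if_neg (by simpa using hn)]
    refine Finset.sum_congr rfl fun n hn => ?_
    rw [if_pos (by simpa [Nat.lt_succ_iff] using hn)]
    simp [qBinomialSeries]
  · have h1 := (((tendsto_qPochhammer q q hq).inv₀ (qPochhammerInf_ne_zero hq hq)).comp
      (tendsto_sub_atTop_nat n)).const_mul (coeff n φ)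
    refine h1.congr' ?_
    filter_upwards [eventually_ge_atTop n] with N hN
    simp [hN]
  · split_ifs
    · rw [norm_mul]
      exact mul_le_mul_of_nonneg_left (hK _) (norm_nonneg _)
    · rw [norm_zero]
      positivity

/-! ### Evaluation of the double series -/

/-- The double series that sums both to the coefficients of `seriesA` and to the sum side. -/
noncomputable def doubleTerm (q : ℂ) (m k : ℕ) : ℂ :=
  q ^ ((m + k) * (m + k + 1)) * (coeff m (qBinomialSeries (-q ^ 2) (q ^ 2) 1) *
    coeff k (qBinomialSeries 0 (q ^ 2) q))

theorem coeff_seriesA (q : ℂ) (n : ℕ) :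
    coeff n (seriesA q) = ∑ z : Finset.HasAntidiagonal.antidiagonal n, doubleTerm q z.1.1 z.1.2 := by
  rw [seriesA, coeff_mk, levelTwoSeries, coeff_mul, Finset.mul_sum,
    ← Finset.sum_coe_sort (Finset.HasAntidiagonal.antidiagonal n)]
  refine Finset.sum_congr rfl fun z _ => ?_
  rw [doubleTerm, Finset.HasAntidiagonal.mem_antidiagonal.1 z.2]

theorem exists_norm_coeff_le {q : ℂ} (hq : ‖q‖ < 1) :
    ∃ K, ∀ n, ‖coeff n (qBinomialSeries (-q ^ 2) (q ^ 2) 1)‖ ≤ K := by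
  have hq2 := norm_sq_lt_one hq
  obtain ⟨K, hK⟩ := exists_norm_qPochhammer_le (-q ^ 2) hq2
  obtain ⟨L, hL⟩ := exists_norm_inv_qPochhammer_le hq2 hq2
  refine ⟨K * L, fun n => ?_⟩
  rw [qBinomialSeries, coeff_mk, one_pow, one_mul, div_eq_mul_inv, norm_mul]
  exact mul_le_mul (hK n) (hL n) (norm_nonneg _) ((norm_nonneg _).trans (hK 0))

theorem summable_norm_doubleTerm {q : ℂ} (hq : ‖q‖ < 1) :
    Summable fun z : ℕ × ℕ => ‖doubleTerm q z.1 z.2‖ := by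
  have hq2 := norm_sq_lt_one hq
  obtain ⟨K, hK⟩ := exists_norm_coeff_le hq
  obtain ⟨L, hL⟩ := exists_norm_inv_qPochhammer_le hq2 hq2
  have hg := summable_geometric_of_lt_one (norm_nonneg q) hq
  have hg2 := ((hg.mul_of_nonneg hg (fun _ => by positivity) fun _ => by positivity)).mul_right
    (K * L)
  refine hg2.of_nonneg_of_le (fun _ => norm_nonneg _) fun z => ?_
  rw [doubleTerm, norm_mul, norm_mul]
  have hK0 : 0 ≤ K := (norm_nonneg _).trans (hK 0)
  refine mul_le_mul ?_ (mul_le_mul (hK _) ?_ (norm_nonneg _) hK0) (by positivity) (by positivity)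
  · rw [norm_pow, ← pow_add]
    exact pow_le_pow_of_le_one (norm_nonneg _) hq.le (by nlinarith)
  · rw [qBinomialSeries, coeff_mk, qPochhammer_zero_left, mul_one, div_eq_mul_inv, norm_mul,
      norm_pow]
    exact (mul_le_of_le_one_left (norm_nonneg _) (pow_le_one₀ (norm_nonneg _) hq.le)).trans (hL _)

theorem summable_norm_coeff_seriesA {q : ℂ} (hq : ‖q‖ < 1) :
    Summable fun n => ‖coeff n (seriesA q)‖ := by
  have h := Finset.HasAntidiagonal.sigmaAntidiagonalEquivProd.summable_iff.2
    (summable_norm_doubleTerm hq)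
  refine h.sigma.of_nonneg_of_le (fun _ => norm_nonneg _) fun n => ?_
  rw [coeff_seriesA, tsum_fintype]
  exact norm_sum_le (E := ℂ) _ _

/-- The part of the exponent involving k is 2·C(k,2) + (3+2m)k, so Euler's identity in base q² gives
(-q^(3+2m);q²)_∞ = (-q³;q²)_∞/(-q³;q²)_m. -/
theorem hasSum_doubleTerm {q : ℂ} (hq : ‖q‖ < 1) (m : ℕ) :
    HasSum (fun k => doubleTerm q m k)
      (q ^ (m * (m + 1)) * qPochhammer (-q ^ 2) (q ^ 2) m /
        (qPochhammer (-q ^ 3) (q ^ 2) m * qPochhammer (q ^ 2) (q ^ 2) m) *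
          qPochhammerInf (-q ^ 3) (q ^ 2)) := by
  have hq2 := norm_sq_lt_one hq
  have hq3 : ‖-q ^ 3‖ < 1 := by
    rw [norm_neg, norm_pow]
    exact pow_lt_one₀ (norm_nonneg _) hq three_ne_zero
  have hy : ‖q ^ 3 * (q ^ 2) ^ m‖ < 1 := norm_mul_pow_lt_one (by rwa [norm_neg] at hq3) hq2 m
  have h := (hasSum_euler hq2 hy).mul_left
    (q ^ (m * (m + 1)) * coeff m (qBinomialSeries (-q ^ 2) (q ^ 2) 1))
  have h1 := qPochhammer_ne_zero hq3 hq2 m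
  have hval : q ^ (m * (m + 1)) * qPochhammer (-q ^ 2) (q ^ 2) m /
      (qPochhammer (-q ^ 3) (q ^ 2) m * qPochhammer (q ^ 2) (q ^ 2) m) *
        qPochhammerInf (-q ^ 3) (q ^ 2) =
      q ^ (m * (m + 1)) * coeff m (qBinomialSeries (-q ^ 2) (q ^ 2) 1) *
        qPochhammerInf (-(q ^ 3 * (q ^ 2) ^ m)) (q ^ 2) := by
    rw [qPochhammerInf_eq_mul (-q ^ 3) hq2 m, qBinomialSeries, coeff_mk, neg_mul]
    field_simp
    simp
  rw [hval]
  refine h.congr_fun fun k => ?_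
  have h2 : (m + k) * (m + k + 1) + k = m * (m + 1) + (2 * k.choose 2 + (3 + 2 * m) * k) := by
    have h3 : 2 * k.choose 2 + k = k * k := by
      rw [Nat.choose_two_right, Nat.mul_div_cancel' (Nat.even_mul_pred_self k).two_dvd]
      cases k <;> simp
      ring
    nlinarith
  have h3 : q ^ ((m + k) * (m + k + 1)) * q ^ k =
      q ^ (m * (m + 1)) * ((q ^ 2) ^ k.choose 2 * (q ^ 3 * (q ^ 2) ^ m) ^ k) := by
    rw [← pow_add, h2]
    ring
  rw [doubleTerm, qBinomialSeries, qBinomialSeries, coeff_mk, coeff_mk, qPochhammer_zero_left]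
  linear_combination (1 ^ m * qPochhammer (-q ^ 2) (q ^ 2) m / qPochhammer (q ^ 2) (q ^ 2) m *
    (qPochhammer (q ^ 2) (q ^ 2) k)⁻¹) * h3

/-- Summing along the antidiagonals gives the left side, summing over k first gives the right side.
-/
theorem tsum_coeff_seriesA {q : ℂ} (hq : ‖q‖ < 1) :
    ∑' n, coeff n (seriesA q) = (∑' n : ℕ, q ^ (n * (n + 1)) * qPochhammer (-q ^ 2) (q ^ 2) n /
        (qPochhammer (-q ^ 3) (q ^ 2) n * qPochhammer (q ^ 2) (q ^ 2) n)) *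
          qPochhammerInf (-q ^ 3) (q ^ 2) := by
  have hs := (summable_norm_doubleTerm hq).of_norm
  have h1 := (Finset.HasAntidiagonal.sigmaAntidiagonalEquivProd.summable_iff.2 hs).tsum_sigma
  have h2 := Equiv.tsum_eq (Finset.HasAntidiagonal.sigmaAntidiagonalEquivProd (A := ℕ))
    fun z => doubleTerm q z.1 z.2
  rw [← tsum_mul_right]
  simp only [← fun m => (hasSum_doubleTerm hq m).tsum_eq]
  rw [← hs.tsum_prod, ← h2]
  refine Eq.trans ?_ h1.symm
  refine tsum_congr fun n => ?_
  rw [coeff_seriesA, tsum_fintype]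
  rfl

end

/-- Up to the nonzero factor (-q³;q²)_∞ the terms are the row sums of the absolutely convergent
double series. -/
theorem summable_sumSide {q : ℂ} (hq : ‖q‖ < 1) :
    Summable fun n : ℕ => q ^ (n * (n + 1)) * qPochhammer (-q ^ 2) (q ^ 2) n /
      (qPochhammer (-q ^ 3) (q ^ 2) n * qPochhammer (q ^ 2) (q ^ 2) n) := by
  have hq3 : ‖-q ^ 3‖ < 1 := by
    rw [norm_neg, norm_pow]
    exact pow_lt_one₀ (norm_nonneg _) hq three_ne_zero
  have h0 := qPochhammerInf_ne_zero hq3 (norm_sq_lt_one hq)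
  refine (summable_mul_right_iff h0).1 ?_
  simp only [← fun m => (hasSum_doubleTerm hq m).tsum_eq]
  exact (summable_norm_doubleTerm hq).of_norm.prod

theorem mainTheorem10 (q : ℂ) (hq : ‖q‖ < 1) :
    Summable (fun n : ℕ =>
      q ^ (n * (n + 1)) * qPochhammer (-q ^ 2) (q ^ 2) n /
        (qPochhammer (-q ^ 3) (q ^ 2) n * qPochhammer (q ^ 2) (q ^ 2) n)) ∧
    HasSum (fun Λ : CylindricPartition (![2, 0, 0, 0] : Fin 4 → ℕ) => q ^ Λ.size)
      ((∑' n : ℕ,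
        q ^ (n * (n + 1)) * qPochhammer (-q ^ 2) (q ^ 2) n /
          (qPochhammer (-q ^ 3) (q ^ 2) n * qPochhammer (q ^ 2) (q ^ 2) n)) *
        (qPochhammerInf (-q ^ 3) (q ^ 2) / qPochhammerInf q q)) := by
  have hlim {x : ℂ} (hx : ‖x‖ < 1) := tendsto_coeff_levelTotal hx (summable_norm_coeff_seriesA hx)
  have hA {x : ℂ} (hx : ‖x‖ < 1) (N : ℕ) : pairSeries x N 4 =
      PowerSeries.coeff N (levelTotal x (seriesA x)) := by
    rw [pairSeries_eq hx]
    rfl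
  have hq' : ‖(‖q‖ : ℂ)‖ < 1 := by simpa using hq
  refine ⟨summable_sumSide hq, ?_⟩
  rw [div_eq_mul_inv, ← mul_assoc, ← tsum_coeff_seriesA hq]
  exact hasSum_cylindric_of_tendsto hq ((hlim hq).congr fun N => (hA hq N).symm)
    ((hlim hq').congr fun N => (hA hq' N).symm)
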